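/- Let $\mathcal{G}$ be an undirected weighted graph on a finite nonempty node set $\{1,\dots,N\}$, with adjacency matrix $W$, $W_{ij}=W_{ji}\ge 0$, degrees $D_{ii}=\sum_j W_{ij}$ and Laplacian $L=D-W$, and let $q>0$. Add an absorbing node $\Delta$ joined to every node with weight $q$: from a node $i\ne\Delta$, the random walk on the extended graph jumps to a node $j\neq\Delta$ with probability $W_{ij}/(D_{ii}+q)$ and to $\Delta$ with probability $q/(D_{ii}+q)$. Wilson's algorithm starts with $\mathcal{V}=\mathcal{Y}=\emptyset$ and, while $\mathcal{V}\ne\{1,\dots,N\}$, repeats the following: start a new random walk from any node $i\notin\mathcal{V}$ (the choice of $i$ may be random and may depend on the whole past of the algorithm, but not on its future jumps) and run it until it reaches $\Delta$ or a node of $\mathcal{V}$; erase the loops of the trajectory in chronological order and add the new nodes that remain to $\mathcal{V}$; if the walk stopped at $\Delta$, add to $\mathcal{Y}$ the last node visited before $\Delta$. The output is $\mathcal{Y}$. Then, for every rule for choosing the starting nodes, the algorithm terminates with probability $1$, and its output $\mathcal{Y}$ is a determinantal point process with marginal kernel $$K_q = q\,(L+qI)^{-1},$$ where $L+qI$ is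 invertible; that is, $0\preceq K_q\preceq I$ and $$\mathbb{P}(S\subseteq\mathcal{Y})=\det\big((K_q)_S\big)\qquad\text{for every } S\subseteq\{1,\dots,N\},$$ where $(K_q)_S$ is the restriction of $K_q$ to the rows and columns indexed by $S$ (and the empty determinant is $1$). Moreover, for every decomposition $L=U\Lambda U^{\mathsf T}$ with $U$ orthogonal and $\Lambda=\mathrm{diag}(\lambda_1,\dots,\lambda_N)$, one has $K_q=U\,g_q(\Lambda)\,U^{\mathsf T}$ with $g_q(\lambda)=\dfrac{q}{q+\lambda}$ and $g_q(\Lambda)=\mathrm{diag}(g_q(\lambda_1),\dots,g_q(\lambda_N))$. -/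

import Mathlib

open Filter Topology Matrix
open scoped ENNReal

/-- An undirected weighted graph on the node set `V`: a symmetric adjacency matrix with
nonnegative entries. -/
structure WeightedGraph (V : Type*) where
  W : Matrix V V ℝ
  symm : ∀ i j, W i j = W j i
  nonneg : ∀ i j, 0 ≤ W i j

namespace WeightedGraph

variable {V : Type*} [Fintype V]

/-- The weighted degree `D i i = ∑ j, W i j`. -/
def degree (G : WeightedGraph V) (i : V) : ℝ := ∑ j, G.W i j

/-- The Laplacian `L = D - W`. -/
def laplacian [DecidableEq V] (G : WeightedGraph V) : Matrix V V ℝ :=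
  Matrix.diagonal G.degree - G.W

theorem degree_nonneg (G : WeightedGraph V) (i : V) : 0 ≤ G.degree i :=
  Finset.sum_nonneg fun j _ => G.nonneg i j

/-- One-step transition probabilities out of the node `i` in the extended graph, whose nodes are
`some j` for `j : V`, together with the absorbing node `Δ = none`. -/
noncomputable def jumpProb (G : WeightedGraph V) (q : ℝ) (i : V) : Option V → ℝ
  | some j => G.W i j / (G.degree i + q)
  | none => q / (G.degree i + q)

theorem sum_jumpProb (G : WeightedGraph V) {q : ℝ} (hq : 0 < q) (i : V) :
    ∑ x, ENNReal.ofReal (G.jumpProb q i x) = 1 := by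
  have hd : 0 < G.degree i + q := add_pos_of_nonneg_of_pos (G.degree_nonneg i) hq
  rw [← ENNReal.ofReal_sum_of_nonneg]
  · rw [Fintype.sum_option]
    simp only [jumpProb]
    rw [← Finset.sum_div, ← add_div]
    change ENNReal.ofReal ((q + G.degree i) / (G.degree i + q)) = 1
    rw [add_comm q, div_self hd.ne', ENNReal.ofReal_one]
  · rintro (_ | j) _
    · exact div_nonneg hq.le hd.le
    · exact div_nonneg (G.nonneg i j) hd.le

/-- The law of the next position of the random walk on the extended graph, from the node `i`. -/
noncomputable def jump (G : WeightedGraph V) {q : ℝ} (hq : 0 < q) (i : V) : PMF (Option V) :=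
  PMF.ofFintype (fun x => ENNReal.ofReal (G.jumpProb q i x)) (G.sum_jumpProb hq i)

end WeightedGraph

/-- Chronological loop erasure of a trajectory: the nodes are read in order, and whenever a node
`x` already on the current path is reached, the loop just closed is erased, that is, the path is
cut back to `x`. (If `x` is not on the path `γ`, then `γ.takeWhile (· ≠ x) = γ`.) -/
def loopErase {V : Type*} [DecidableEq V] (t : List V) : List V :=
  t.foldl (fun γ x => γ.takeWhile (fun y => decide (y ≠ x)) ++ [x]) []

/-- The state of Wilson's algorithm. -/
structure WilsonState (V : Type*) where
  /-- the set `𝒱` of nodes already covered -/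
  visited : Finset V
  /-- the set `𝒴` of the nodes recorded so far -/
  roots : Finset V
  /-- the trajectory so far of the walk in progress; `[]` if no walk is in progress -/
  current : List V
  /-- the completed walks, most recent first: the trajectory up to the stopping position, and the
  stopping position (`none` is `Δ`, `some j` is the node `j`, covered by an earlier walk) -/
  past : List (List V × Option V)

namespace WilsonState

variable {V : Type*} [DecidableEq V]

/-- `𝒱 = 𝒴 = ∅`, no walk done or in progress. -/
def init : WilsonState V := ⟨∅, ∅, [], []⟩

/-- The walk in progress, now at `i`, moves to `x`. It stops if `x` is `Δ` or a covered node; then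
the nodes of its loop erasure are added to `𝒱`, and, if `x` is `Δ`, the last node `i` before `Δ`
is added to `𝒴`. Otherwise the trajectory is extended by `x`. -/
def move (s : WilsonState V) (i : V) (x : Option V) : WilsonState V :=
  match x with
  | none =>
      { visited := s.visited ∪ (loopErase s.current).toFinset
        roots := insert i s.roots
        current := []
        past := (s.current, none) :: s.past }
  | some j =>
      if j ∈ s.visited then
        { visited := s.visited ∪ (loopErase s.current).toFinset
          roots := s.roots
          current := []
          past := (s.current, some j) :: s.past }
      else
        { s with current := s.current ++ [j] }

end WilsonState

/-- A rule that picks the starting node of the next walk among the nodes not yet covered. The pick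
may be random, and may depend on the whole past of the algorithm. -/
def IsStartRule {V : Type*} [Fintype V] (rule : WilsonState V → PMF V) : Prop :=
  ∀ s : WilsonState V, s.visited ≠ Finset.univ → ∀ i ∈ (rule s).support, i ∉ s.visited

section Wilson

variable {V : Type*} [Fintype V] [DecidableEq V]

/-- One step of Wilson's algorithm: stay put if all nodes are covered; start a new walk if none is
in progress; otherwise let the walk in progress make one jump. -/
noncomputable def wilsonStep (G : WeightedGraph V) {q : ℝ} (hq : 0 < q)
    (rule : WilsonState V → PMF V) (s : WilsonState V) : PMF (WilsonState V) :=
  if s.visited = Finset.univ then PMF.pure s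
  else
    match s.current.getLast? with
    | none => (rule s).map fun i => { s with current := [i] }
    | some i => (G.jump hq i).map (s.move i)

/-- The law of the state of Wilson's algorithm after `n` steps. -/
noncomputable def wilsonRun (G : WeightedGraph V) {q : ℝ} (hq : 0 < q)
    (rule : WilsonState V → PMF V) : ℕ → PMF (WilsonState V)
  | 0 => PMF.pure WilsonState.init
  | n + 1 => (wilsonRun G hq rule n).bind (wilsonStep G hq rule)

/-- `p` is the law of the output `𝒴` of Wilson's algorithm: for every set `A`, the probability of
having terminated within `n` steps with output `A` increases to `p A`. As `p` has total mass `1`,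
this contains that the algorithm terminates with probability `1`. -/
def IsWilsonOutputLaw (G : WeightedGraph V) {q : ℝ} (hq : 0 < q)
    (rule : WilsonState V → PMF V) (p : PMF (Finset V)) : Prop :=
  ∀ A : Finset V,
    Tendsto (fun n => (wilsonRun G hq rule n).toOuterMeasure
      {s | s.visited = Finset.univ ∧ s.roots = A}) atTop (𝓝 (p A))

/-- The random subset of `V` with law `p` is a determinantal point process with marginal kernel
`K`: `0 ≼ K ≼ 1`, and `S ⊆ 𝒜` has probability `det K_S` for every set `S` of nodes. -/
def IsDPP (p : PMF (Finset V)) (K : Matrix V V ℝ) : Prop :=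
  K.PosSemidef ∧ (1 - K).PosSemidef ∧
    ∀ S : Finset V, (p.toOuterMeasure {A | S ⊆ A}).toReal =
      (K.submatrix (Subtype.val : S → V) (Subtype.val : S → V)).det

/-- `L = U Λ Uᵀ` with `U` orthogonal and `Λ = diag(lam)`. -/
def IsEigendecomposition (L U : Matrix V V ℝ) (lam : V → ℝ) : Prop :=
  U ∈ Matrix.orthogonalGroup V ℝ ∧ L = U * Matrix.diagonal lam * Uᵀ

/-- The graph filter `U h(Λ) Uᵀ` with frequency response `h`. -/
def graphFilter (U : Matrix V V ℝ) (lam : V → ℝ) (h : ℝ → ℝ) : Matrix V V ℝ :=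
  U * Matrix.diagonal (fun i => h (lam i)) * Uᵀ

end Wilson

/-!
The algorithm is followed through an explicit bounded martingale. Fix weights `s i` and put
`N = diag(s) L + q` and `M = L + q`. The expectation of `∏ i ∉ 𝒴, s i` is to be `det N / det M`;
for `s = 0` on `S` and `s = 1` elsewhere, the product is the indicator of `S ⊆ 𝒴`, and
`det N / det M` is the minor on `S` of `q M⁻¹` (`det_tiltedMatrix_div`).

Between two walks, the conditional expectation given the covered set `U` is the product over `U` of
the weights already decided, times the ratio of the principal minors of `N` and `M` on the
complement of `U`. During a walk it depends on the loop erasure of the trajectory as well. If the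
walk is at `x` and `l` is the rest of the loop-erased path, then the walk leaves the complement of
`U ∪ l` either through `U` or `Δ`, or by returning to a node of `l`. In the second case the path is
cut back to a shorter one, where the value is known by recursion, and the contribution is the
solution at `x` of a Dirichlet problem for `M`. In the first case it turns out to be
`∏ i ∈ l, s i` times a Cramer determinant of `N`, divided by a principal minor of `M`; this is
`pathValue`. Its harmonicity (`pathValue_harmonic`) reduces to the expansion of a determinant
bordered by a row and a column (`cramer_updateRow_apply_self`). Principal minors are encoded as
determinants of full-size matrices with rows of the identity outside the index set, so that the
solutions of Dirichlet problems carry their boundary values.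

For the path with the single node `x`, the constant `1` solves the Dirichlet problem for `N`, since
`L 1 = 0`. So the value at the start of a walk is the value before it, whatever the starting node
(`stateValue_start`); this is why the rule does not matter. Finally, each walk covers a new node,
and each jump reaches `Δ` with probability bounded below, which gives a Lyapunov function
(`remainingSteps`) and termination with probability `1`; optional stopping concludes
(`IsWilsonOutputLaw.toOuterMeasure_subset`).
-/

/-! ### Determinants of row-masked matrices -/

section Determinants

variable {V : Type*} [DecidableEq V]

/-- The matrix `N` with the rows outside `C` replaced by those of the identity. Its determinant is
the principal minor of `N` on `C`. -/
def maskRows (N : Matrix V V ℝ) (C : Finset V) : Matrix V V ℝ :=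
  Matrix.of fun i j => if i ∈ C then N i j else (1 : Matrix V V ℝ) i j

theorem maskRows_row_of_notMem (N : Matrix V V ℝ) {C : Finset V} {x : V} (hx : x ∉ C) :
    maskRows N C x = Pi.single x 1 := by
  ext j
  simp [maskRows, hx, Matrix.one_apply, Pi.single_apply, eq_comm]

theorem maskRows_updateRow (N : Matrix V V ℝ) {C : Finset V} {x : V} (hx : x ∈ C) :
    (maskRows N (C.erase x)).updateRow x (N x) = maskRows N C := by
  ext i j
  by_cases hi : i = x
  · subst hi; simp [maskRows, hx]
  · simp [maskRows, hi]

variable [Fintype V]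

/-- Cramer's rule in a row of the identity: the solution takes the prescribed value there. -/
theorem cramer_apply_of_row_eq_single {A : Matrix V V ℝ} {x : V} (hA : A x = Pi.single x 1)
    (c : V → ℝ) : A.cramer c x = A.det * c x := by
  have h := congrFun (A.mulVec_cramer c) x
  rw [Matrix.mulVec, hA, single_one_dotProduct] at h
  simpa using h

/-- If row `x` is a row of the identity, then column `x` does not affect the determinant. -/
theorem det_eq_of_row_eq_single {A B : Matrix V V ℝ} {x : V} (hA : A x = Pi.single x 1)
    (hB : B x = Pi.single x 1) (h : ∀ i j, j ≠ x → A i j = B i j) : A.det = B.det := by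
  have key : ∀ {C : Matrix V V ℝ}, C x = Pi.single x 1 →
      C.det = (C.updateCol x (Pi.single x 1)).det := by
    intro C hC
    have := cramer_apply_of_row_eq_single hC (Pi.single x 1)
    rw [Matrix.cramer_apply] at this
    simpa using this.symm
  rw [key hA, key hB]
  congr 1
  ext i j
  by_cases hj : j = x
  · subst hj; simp
  · simp [hj, h i j hj]

theorem det_updateRow_eq_dotProduct_cramer (P : Matrix V V ℝ) (x : V) (r : V → ℝ) :
    (P.updateRow x r).det = r ⬝ᵥ P.cramer (Pi.single x 1) := by
  rw [← Matrix.cramer_transpose_apply, Matrix.cramer_eq_adjugate_mulVec,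
    Matrix.cramer_eq_adjugate_mulVec, ← Matrix.adjugate_transpose, Matrix.mulVec_single_one,
    Matrix.mulVec, dotProduct_comm]
  rfl

/-- The sign comes from exchanging the columns `x` and `y`. -/
theorem det_updateCol_updateRow_single {P : Matrix V V ℝ} {x y : V} (hP : P x = Pi.single x 1)
    (hy : y ≠ x) (c : V → ℝ) :
    ((P.updateCol x c).updateRow x (Pi.single y 1)).det
      = - P.cramer (Function.update c x 0) y := by
  rw [Matrix.cramer_apply, ← neg_eq_iff_eq_neg]
  have hs := Matrix.det_permute' (Equiv.swap x y)
    ((P.updateCol x c).updateRow x (Pi.single y 1))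
  rw [Equiv.Perm.sign_swap hy.symm] at hs
  rw [show - ((P.updateCol x c).updateRow x (Pi.single y 1)).det = _ from by
    simpa using hs.symm]
  apply det_eq_of_row_eq_single (x := x)
  · ext j
    simp only [Matrix.submatrix_apply, id, Matrix.updateRow_self]
    by_cases h : j = x
    · subst h; simp
    · have : Equiv.swap x y j ≠ y := fun e => h (by
        have := congrArg (Equiv.swap x y) e
        simpa using this)
      simp [h, this]
  · ext j
    by_cases h : j = y
    · subst h; simp [hy]
    · simp [h, hP]
  · intro i j hj
    by_cases hi : i = x
    · subst hi
      by_cases h : j = y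
      · subst h; simp [hj.symm]
      · have : Equiv.swap i y j ≠ y := fun e => hj (by
          have := congrArg (Equiv.swap i y) e
          simpa using this)
        simp [this, h, hP, hj]
    · by_cases h : j = y
      · subst h; simp [hi]
      · simp [hi, h, Equiv.swap_apply_of_ne_of_ne hj h, hj]

/-- Expansion of a determinant bordered by the row `r` and the column `c`, both passing
through `x`. -/
theorem cramer_updateRow_apply_self {P : Matrix V V ℝ} {x : V} (hP : P x = Pi.single x 1)
    (r c : V → ℝ) :
    (P.updateRow x r).cramer c x
      = c x * P.det - r ⬝ᵥ P.cramer (Function.update c x 0) := by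
  have h1 : (P.updateRow x r).updateCol x c
      = (P.updateCol x c).updateRow x (Function.update r x (c x)) := by
    ext i j
    by_cases hi : i = x <;> by_cases hj : j = x <;>
      simp [Matrix.updateRow_apply, hi, hj]
  have h2 : ∀ y, (P.updateCol x c).cramer (Pi.single x 1) y
      = ((P.updateCol x c).updateRow x (Pi.single y 1)).det := by
    intro y
    rw [det_updateRow_eq_dotProduct_cramer, single_one_dotProduct]
  have h3 : ((P.updateCol x c).updateRow x (Pi.single x 1)).det = P.det := by
    apply det_eq_of_row_eq_single (x := x) (by ext j; simp) hP
    intro i j hj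
    by_cases hi : i = x
    · subst hi; simp [hP]
    · simp [hi, hj]
  rw [Matrix.cramer_apply, h1, det_updateRow_eq_dotProduct_cramer, dotProduct, dotProduct,
    ← Finset.add_sum_erase _ _ (Finset.mem_univ x),
    ← Finset.add_sum_erase _ (fun i => r i * _) (Finset.mem_univ x), h2, h3,
    cramer_apply_of_row_eq_single hP]
  simp only [Function.update_self, mul_zero, zero_add]
  rw [sub_eq_add_neg, ← Finset.sum_neg_distrib]
  congr 1
  apply Finset.sum_congr rfl
  intro y hy
  have hy := Finset.ne_of_mem_erase hy
  rw [h2, det_updateCol_updateRow_single hP hy, Function.update_of_ne hy]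
  ring

theorem cramer_maskRows_of_notMem (N : Matrix V V ℝ) {C : Finset V} {y : V} (hy : y ∉ C)
    (c : V → ℝ) : (maskRows N C).cramer c y = (maskRows N C).det * c y :=
  cramer_apply_of_row_eq_single (maskRows_row_of_notMem N hy) c

theorem det_maskRows_eq_mulVec (N : Matrix V V ℝ) {C : Finset V} {x : V} (hx : x ∈ C) :
    (maskRows N C).det = (N *ᵥ (maskRows N (C.erase x)).cramer (Pi.single x 1)) x := by
  rw [← maskRows_updateRow N hx, det_updateRow_eq_dotProduct_cramer]; rfl

theorem cramer_maskRows_eq_mulVec (N : Matrix V V ℝ) {C : Finset V} {x : V} (hx : x ∈ C)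
    (c : V → ℝ) :
    (maskRows N C).cramer c x = c x * (maskRows N (C.erase x)).det
      - (N *ᵥ (maskRows N (C.erase x)).cramer (Function.update c x 0)) x := by
  rw [← maskRows_updateRow N hx, cramer_updateRow_apply_self
    (maskRows_row_of_notMem N (Finset.notMem_erase x C))]; rfl

theorem det_maskRows_empty (N : Matrix V V ℝ) : (maskRows N ∅).det = 1 := by
  have : maskRows N ∅ = 1 := by ext i j; simp [maskRows]
  rw [this, Matrix.det_one]

theorem maskRows_univ (N : Matrix V V ℝ) : maskRows N Finset.univ = N := by
  ext i j; simp [maskRows]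

theorem det_maskRows_eq_det_submatrix (N : Matrix V V ℝ) (S : Finset V) :
    (maskRows N S).det =
      (N.submatrix (Subtype.val : S → V) (Subtype.val : S → V)).det := by
  rw [Matrix.twoBlockTriangular_det (maskRows N S) (fun i => i ∈ S)]
  · have h1 : (maskRows N S).toSquareBlockProp (fun i => i ∈ S)
        = N.submatrix (Subtype.val : S → V) (Subtype.val : S → V) := by
      ext i j
      simp [maskRows, Matrix.toSquareBlockProp, Matrix.toBlock]
    have h2 : (maskRows N S).toSquareBlockProp (fun i => i ∉ S) = 1 := by
      ext i j
      simp [maskRows, Matrix.toSquareBlockProp, Matrix.toBlock, i.2, Matrix.one_apply,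
        Subtype.ext_iff]
    rw [h2, Matrix.det_one, mul_one]
    rw [← h1]
    congr!
  · intro i hi j hj
    have : i ≠ j := fun h => hi (h ▸ hj)
    simp [maskRows, hi, this]

end Determinants

/-! ### The tilted matrix and the value of a walk in progress -/

section PathValue

variable {V : Type*} [Fintype V] [DecidableEq V]

/-- The matrix `diag(s) L + q`: in the extended graph, the weights of the jumps from `i` to nodes
are multiplied by `s i`, and those of the jumps to `Δ` are kept. -/
def tiltedMatrix (G : WeightedGraph V) (q : ℝ) (s : V → ℝ) : Matrix V V ℝ :=
  Matrix.diagonal s * G.laplacian + q • (1 : Matrix V V ℝ)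

theorem tiltedMatrix_one (G : WeightedGraph V) (q : ℝ) :
    tiltedMatrix G q 1 = G.laplacian + q • (1 : Matrix V V ℝ) := by
  have : Matrix.diagonal (1 : V → ℝ) = 1 := Matrix.diagonal_one
  rw [tiltedMatrix, this, one_mul]

theorem laplacian_mulVec_apply (G : WeightedGraph V) (f : V → ℝ) (x : V) :
    (G.laplacian *ᵥ f) x = G.degree x * f x - ∑ y, G.W x y * f y := by
  rw [WeightedGraph.laplacian, Matrix.sub_mulVec, Pi.sub_apply, Matrix.mulVec_diagonal]
  rfl

theorem tiltedMatrix_mulVec_apply (G : WeightedGraph V) (q : ℝ) (s f : V → ℝ) (x : V) :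
    (tiltedMatrix G q s *ᵥ f) x =
      s x * (G.degree x * f x - ∑ y, G.W x y * f y) + q * f x := by
  rw [tiltedMatrix, Matrix.add_mulVec, ← Matrix.mulVec_mulVec, Pi.add_apply,
    Matrix.mulVec_diagonal, laplacian_mulVec_apply, Matrix.smul_mulVec, Matrix.one_mulVec]
  rfl

/-- The masked matrix is strictly diagonally dominant. -/
theorem det_maskRows_tiltedMatrix_one_ne_zero (G : WeightedGraph V) {q : ℝ} (hq : 0 < q)
    (C : Finset V) : (maskRows (tiltedMatrix G q 1) C).det ≠ 0 := by
  apply det_ne_zero_of_sum_row_lt_diag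
  intro k
  by_cases hk : k ∈ C
  · have h1 : ∀ j ∈ Finset.univ.erase k,
        ‖maskRows (tiltedMatrix G q 1) C k j‖ = G.W k j := by
      intro j hj
      have hj := (Finset.ne_of_mem_erase hj).symm
      simp [maskRows, hk, tiltedMatrix_one, WeightedGraph.laplacian, hj,
        abs_of_nonneg (G.nonneg k j)]
    have h2 : maskRows (tiltedMatrix G q 1) C k k
        = ∑ j ∈ Finset.univ.erase k, G.W k j + q := by
      have := Finset.add_sum_erase Finset.univ (G.W k) (Finset.mem_univ k)
      have h : maskRows (tiltedMatrix G q 1) C k k = G.degree k - G.W k k + q := by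
        simp [maskRows, hk, tiltedMatrix_one, WeightedGraph.laplacian]
      rw [h, WeightedGraph.degree, ← this]
      ring
    rw [Finset.sum_congr rfl h1, h2]
    exact lt_of_lt_of_le (lt_add_of_pos_right _ hq) (le_abs_self _)
  · rw [maskRows_row_of_notMem _ hk, Finset.sum_eq_zero]
    · simp
    · intro j hj
      simp [Finset.ne_of_mem_erase hj]

/-- Boundary and source data of a walk started outside `U ∪ l`: the nodes of `U` have the value
`1`, those of `l` the value `0`, and the other nodes jump to `Δ` with weight `q`. -/
def exitData (q : ℝ) (U : Finset V) (l : List V) : V → ℝ :=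
  fun i => if i ∈ U then 1 else if i ∈ l then 0 else q

/-- As `L 1 = 0`, the Dirichlet problem with the data of an empty path is solved by the constant
`1`. Hence the value of a walk does not depend on its starting node. -/
theorem tiltedMatrix_cramer_exitData_nil (G : WeightedGraph V) (q : ℝ) (s : V → ℝ)
    (U : Finset V) (x : V) :
    (maskRows (tiltedMatrix G q s) Uᶜ).cramer (exitData q U []) x
      = (maskRows (tiltedMatrix G q s) Uᶜ).det := by
  have h : exitData q U [] = maskRows (tiltedMatrix G q s) Uᶜ *ᵥ (1 : V → ℝ) := by
    ext i
    by_cases hi : i ∈ U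
    · have := maskRows_row_of_notMem (tiltedMatrix G q s) (C := Uᶜ) (x := i) (by simpa using hi)
      rw [Matrix.mulVec, this, single_one_dotProduct]
      simp [exitData, hi]
    · have : (maskRows (tiltedMatrix G q s) Uᶜ *ᵥ (1 : V → ℝ)) i
          = (tiltedMatrix G q s *ᵥ (1 : V → ℝ)) i := by
        simp [Matrix.mulVec, dotProduct, maskRows, hi]
      rw [this, tiltedMatrix_mulVec_apply]
      simp [exitData, hi, WeightedGraph.degree]
  rw [h, Matrix.cramer_eq_adjugate_mulVec, Matrix.mulVec_mulVec, Matrix.adjugate_mul,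
    Matrix.smul_mulVec, Matrix.one_mulVec]
  simp

/-- The list is a loop-erased path in reverse order. The value at a node `x` of the list is the
conditional expectation of `∏ i ∉ 𝒴, s i`, up to the factor coming from the covered set `U`, given
that the walk in progress is at `x` and its loop erasure is the part of the path up to `x`. If `l`
is this part without `x`, the first summand is the contribution of the event that the walk from `x`
leaves the complement of `U ∪ l` through `U` or `Δ`; the second one is that of its return to a node
of `l`, where the value is already known. Off the list the value is `0`. -/
noncomputable def pathValue (G : WeightedGraph V) (q : ℝ) (s : V → ℝ) (U : Finset V) :
    List V → V → ℝ
  | [] => 0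
  | x :: l => Function.update (pathValue G q s U l) x
      (((∏ i ∈ l.toFinset, s i) *
          (maskRows (tiltedMatrix G q s) (U ∪ l.toFinset)ᶜ).cramer (exitData q U l) x
        + (maskRows (tiltedMatrix G q 1) (U ∪ l.toFinset)ᶜ).cramer (pathValue G q s U l) x)
        / (maskRows (tiltedMatrix G q 1) (U ∪ l.toFinset)ᶜ).det)

theorem pathValue_cons_self (G : WeightedGraph V) (q : ℝ) (s : V → ℝ) (U : Finset V) (x : V)
    (l : List V) : pathValue G q s U (x :: l) x =
      ((∏ i ∈ l.toFinset, s i) *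
          (maskRows (tiltedMatrix G q s) (U ∪ l.toFinset)ᶜ).cramer (exitData q U l) x
        + (maskRows (tiltedMatrix G q 1) (U ∪ l.toFinset)ᶜ).cramer (pathValue G q s U l) x)
        / (maskRows (tiltedMatrix G q 1) (U ∪ l.toFinset)ᶜ).det := by
  rw [pathValue, Function.update_self]

theorem pathValue_of_notMem (G : WeightedGraph V) (q : ℝ) (s : V → ℝ) (U : Finset V) {y : V} :
    ∀ {l : List V}, y ∉ l → pathValue G q s U l y = 0
  | [], _ => rfl
  | x :: l, h => by
    rw [List.mem_cons, not_or] at h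
    rw [pathValue, Function.update_of_ne h.1, pathValue_of_notMem G q s U h.2]

theorem pathValue_append (G : WeightedGraph V) (q : ℝ) (s : V → ℝ) (U : Finset V) {y : V}
    (l : List V) : ∀ {l' : List V}, y ∉ l' → pathValue G q s U (l' ++ l) y = pathValue G q s U l y
  | [], _ => rfl
  | x :: l', h => by
    rw [List.mem_cons, not_or] at h
    rw [List.cons_append, pathValue, Function.update_of_ne h.1, pathValue_append G q s U l h.2]

theorem pathValue_singleton (G : WeightedGraph V) (q : ℝ) (s : V → ℝ) (U : Finset V) (x : V) :
    pathValue G q s U [x] x = (maskRows (tiltedMatrix G q s) Uᶜ).det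
      / (maskRows (tiltedMatrix G q 1) Uᶜ).det := by
  rw [pathValue_cons_self]
  simp [pathValue, tiltedMatrix_cramer_exitData_nil]

/-- The value of a walk at `x` is the mean of the values after its next jump: to `Δ`, to a
node of `U`, back to a node of the path, or to a new node. -/
theorem pathValue_harmonic (G : WeightedGraph V) {q : ℝ} (hq : 0 < q) (s : V → ℝ) (U : Finset V)
    (x : V) (l : List V) (hxU : x ∉ U) (hxl : x ∉ l) (hlU : ∀ y ∈ l, y ∉ U) :
    (G.degree x + q) * pathValue G q s U (x :: l) x =
      q * ((∏ i ∈ l.toFinset, s i)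
        * ((maskRows (tiltedMatrix G q s) (U ∪ (x :: l).toFinset)ᶜ).det
          / (maskRows (tiltedMatrix G q 1) (U ∪ (x :: l).toFinset)ᶜ).det))
      + ∑ y, G.W x y *
        (if y ∈ U then (∏ i ∈ (x :: l).toFinset, s i)
            * ((maskRows (tiltedMatrix G q s) (U ∪ (x :: l).toFinset)ᶜ).det
              / (maskRows (tiltedMatrix G q 1) (U ∪ (x :: l).toFinset)ᶜ).det)
          else if y ∈ x :: l then pathValue G q s U (x :: l) y
          else pathValue G q s U (y :: x :: l) y) := by
  have hxC : x ∈ (U ∪ l.toFinset)ᶜ := by simp [hxU, hxl]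
  have hB : (U ∪ (x :: l).toFinset)ᶜ = (U ∪ l.toFinset)ᶜ.erase x := by
    ext y; simp only [Finset.mem_compl, Finset.mem_union, List.mem_toFinset, List.mem_cons,
      Finset.mem_erase]; tauto
  have hmB := det_maskRows_tiltedMatrix_one_ne_zero G hq (U ∪ (x :: l).toFinset)ᶜ
  have hmC := det_maskRows_tiltedMatrix_one_ne_zero G hq (U ∪ l.toFinset)ᶜ
  have hprod : ∏ i ∈ (x :: l).toFinset, s i = s x * ∏ i ∈ l.toFinset, s i := by
    rw [List.toFinset_cons, Finset.prod_insert (by simpa using hxl)]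
  have hself := pathValue_cons_self G q s U x l
  have hN := cramer_maskRows_eq_mulVec (tiltedMatrix G q s) hxC (exitData q U l)
  have hM := cramer_maskRows_eq_mulVec (tiltedMatrix G q 1) hxC (pathValue G q s U l)
  have hD := det_maskRows_eq_mulVec (tiltedMatrix G q 1) hxC
  have hφx : pathValue G q s U l x = 0 := pathValue_of_notMem G q s U hxl
  have hexit : Function.update (exitData q U l) x 0 = exitData q U (x :: l) := by
    ext y
    by_cases hy : y = x
    · subst hy; simp [exitData, hxU]
    · simp [exitData, hy]
  have hφ : pathValue G q s U (x :: l)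
      = pathValue G q s U l + pathValue G q s U (x :: l) x • Pi.single x 1 := by
    ext y
    by_cases hy : y = x
    · subst hy; simp [hφx]
    · rw [pathValue, Function.update_of_ne hy]; simp [hy]
  rw [← hB] at hN hM hD
  rw [hexit] at hN
  rw [← hφx, Function.update_eq_self, hφx] at hM
  have hex : exitData q U l x = q := by simp [exitData, hxU, hxl]
  rw [hex] at hN
  set φ' := pathValue G q s U (x :: l) with hφ'
  set h0 := φ' x with hh0
  set B := (U ∪ (x :: l).toFinset)ᶜ with hBdef
  set P := ∏ i ∈ l.toFinset, s i with hP
  -- The values after a jump to any node are given by one pair of Cramer solutions, whose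
  -- boundary values take care of the nodes that are covered or on the path.
  have hval : ∀ y, (if y ∈ U then (∏ i ∈ (x :: l).toFinset, s i)
            * ((maskRows (tiltedMatrix G q s) B).det / (maskRows (tiltedMatrix G q 1) B).det)
          else if y ∈ x :: l then φ' y else pathValue G q s U (y :: x :: l) y)
      = ((s x * P) * (maskRows (tiltedMatrix G q s) B).cramer (exitData q U (x :: l)) y
        + (maskRows (tiltedMatrix G q 1) B).cramer φ' y) / (maskRows (tiltedMatrix G q 1) B).det := by
    intro y
    split_ifs with h1 h2
    · have hyB : y ∉ B := by simp [hBdef, h1]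
      have hyl : y ∉ x :: l := by
        rw [List.mem_cons, not_or]
        exact ⟨fun e => hxU (e ▸ h1), fun e => hlU y e h1⟩
      rw [cramer_maskRows_of_notMem _ hyB, cramer_maskRows_of_notMem _ hyB, hφ',
        pathValue_of_notMem G q s U hyl, hprod]
      simp [exitData, h1]
      ring
    · have hyB : y ∉ B := by
        rw [hBdef, Finset.mem_compl, not_not, Finset.mem_union, List.mem_toFinset]
        exact Or.inr h2
      rw [cramer_maskRows_of_notMem _ hyB, cramer_maskRows_of_notMem _ hyB]
      have : exitData q U (x :: l) y = 0 := by simp only [exitData, h1, h2, if_true, if_false]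
      rw [this]
      field_simp
      ring
    · rw [pathValue_cons_self, hprod]
  simp only [hval]
  have hxB : x ∉ B := by simp [hBdef]
  have hcN : (maskRows (tiltedMatrix G q s) B).cramer (exitData q U (x :: l)) x = 0 := by
    rw [cramer_maskRows_of_notMem _ hxB]; simp [exitData, hxU]
  have hcM : (maskRows (tiltedMatrix G q 1) B).cramer φ' x
      = (maskRows (tiltedMatrix G q 1) B).det * h0 := cramer_maskRows_of_notMem _ hxB _
  have hlin : (tiltedMatrix G q 1 *ᵥ (maskRows (tiltedMatrix G q 1) B).cramer φ') x
      = (tiltedMatrix G q 1 *ᵥ (maskRows (tiltedMatrix G q 1) B).cramer (pathValue G q s U l)) x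
        + h0 * (tiltedMatrix G q 1 *ᵥ
          (maskRows (tiltedMatrix G q 1) B).cramer (Pi.single x 1)) x := by
    rw [hφ, map_add, map_smul, Matrix.mulVec_add, Matrix.mulVec_smul]
    simp
  rw [tiltedMatrix_mulVec_apply, hcM] at hlin
  rw [tiltedMatrix_mulVec_apply, hcN] at hN
  rw [eq_div_iff hmC] at hself
  have hsum : ∑ y, G.W x y * (((s x * P) *
        (maskRows (tiltedMatrix G q s) B).cramer (exitData q U (x :: l)) y
        + (maskRows (tiltedMatrix G q 1) B).cramer φ' y) / (maskRows (tiltedMatrix G q 1) B).det)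
      = (s x * P * ∑ y, G.W x y *
          (maskRows (tiltedMatrix G q s) B).cramer (exitData q U (x :: l)) y
        + ∑ y, G.W x y * (maskRows (tiltedMatrix G q 1) B).cramer φ' y)
          / (maskRows (tiltedMatrix G q 1) B).det := by
    rw [Finset.mul_sum, ← Finset.sum_add_distrib, Finset.sum_div]
    exact Finset.sum_congr rfl fun y _ => by ring
  rw [hsum]
  simp only [Pi.one_apply, one_mul, mul_zero, zero_sub] at hlin hN hM
  rw [← hD] at hlin
  field_simp
  linear_combination hlin + hM + hself + P * hN

end PathValue

/-! ### Loop erasure -/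

section LoopErase

variable {V : Type*} [DecidableEq V]

theorem loopErase_append_singleton (t : List V) (x : V) :
    loopErase (t ++ [x]) = (loopErase t).takeWhile (fun y => decide (y ≠ x)) ++ [x] := by
  simp [loopErase, List.foldl_append]

theorem mem_of_mem_takeWhile_ne {γ : List V} {x y : V}
    (h : y ∈ γ.takeWhile (fun y => decide (y ≠ x))) : y ∈ γ ∧ y ≠ x :=
  ⟨(List.takeWhile_sublist _).subset h, by simpa using List.mem_takeWhile_imp h⟩

theorem loopErase_subset (t : List V) : ∀ x ∈ loopErase t, x ∈ t := by
  induction t using List.reverseRecOn with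
  | nil => simp [loopErase]
  | append_singleton t a ih =>
    intro x hx
    rw [loopErase_append_singleton, List.mem_append] at hx
    rw [List.mem_append]
    exact hx.imp_left fun h => ih x (mem_of_mem_takeWhile_ne h).1

theorem loopErase_nodup (t : List V) : (loopErase t).Nodup := by
  induction t using List.reverseRecOn with
  | nil => simp [loopErase]
  | append_singleton t a ih =>
    rw [loopErase_append_singleton, List.nodup_append]
    refine ⟨ih.sublist (List.takeWhile_sublist _), List.nodup_singleton a, ?_⟩
    intro x hx b hb
    rw [List.mem_singleton] at hb
    exact hb ▸ (mem_of_mem_takeWhile_ne hx).2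

theorem takeWhile_ne_of_notMem {γ : List V} {y : V} (h : y ∉ γ) :
    γ.takeWhile (fun z => decide (z ≠ y)) = γ := by
  rw [List.takeWhile_eq_self_iff]
  intro z hz
  simpa using fun e : z = y => h (e ▸ hz)

theorem exists_eq_takeWhile_ne_append {γ : List V} {y : V} (h : y ∈ γ) :
    ∃ r, γ = γ.takeWhile (fun z => decide (z ≠ y)) ++ y :: r := by
  induction γ with
  | nil => simp at h
  | cons a γ ih =>
    by_cases ha : a = y
    · exact ⟨γ, by simp [ha]⟩
    · obtain ⟨r, hr⟩ := ih ((List.mem_cons.1 h).resolve_left (Ne.symm ha))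
      refine ⟨r, ?_⟩
      rw [List.takeWhile_cons_of_pos (by simpa using ha), List.cons_append, ← hr]

end LoopErase

/-! ### The harmonic function of Wilson's algorithm -/

/-- The invariants of Wilson's algorithm: only covered nodes are recorded, and the walk in progress
has not met a covered node. -/
def WilsonState.Consistent {V : Type*} (st : WilsonState V) : Prop :=
  st.roots ⊆ st.visited ∧ ∀ v ∈ st.current, v ∉ st.visited

theorem WilsonState.Consistent.current_eq_nil {V : Type*} [Fintype V]
    {st : WilsonState V} (hst : st.Consistent)
    (h : st.visited = Finset.univ) : st.current = [] :=
  List.eq_nil_iff_forall_not_mem.2 fun v hv => hst.2 v hv (h ▸ Finset.mem_univ v)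

section StateValue

variable {V : Type*} [DecidableEq V]

/-- What the covered nodes `U` contribute to `∏ i ∉ R, s i`. -/
def rootWeight (s : V → ℝ) (U R : Finset V) : ℝ := ∏ i ∈ U, if i ∈ R then 1 else s i

theorem rootWeight_union {s : V → ℝ} {U R F : Finset V} (hR : R ⊆ U) (hF : Disjoint U F) :
    rootWeight s (U ∪ F) R = rootWeight s U R * ∏ i ∈ F, s i := by
  rw [rootWeight, Finset.prod_union hF, rootWeight]
  congr 1
  refine Finset.prod_congr rfl fun i hi => if_neg fun h => ?_
  exact Finset.disjoint_left.1 hF (hR h) hi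

theorem rootWeight_union_insert {s : V → ℝ} {U R F : Finset V} {x : V} (hR : R ⊆ U)
    (hF : Disjoint U (insert x F)) (hx : x ∉ F) :
    rootWeight s (U ∪ insert x F) (insert x R) = rootWeight s U R * ∏ i ∈ F, s i := by
  rw [rootWeight, Finset.prod_union hF, rootWeight, Finset.prod_insert hx,
    if_pos (Finset.mem_insert_self _ _), one_mul]
  have hxU : x ∉ U := fun h => Finset.disjoint_left.1 hF h (Finset.mem_insert_self _ _)
  congr 1
  · refine Finset.prod_congr rfl fun i hi => ?_
    have : i ≠ x := fun e => hxU (e ▸ hi)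
    simp [this]
  · refine Finset.prod_congr rfl fun i hi => if_neg fun h => ?_
    rcases Finset.mem_insert.1 h with h | h
    · exact hx (h ▸ hi)
    · exact Finset.disjoint_left.1 hF (hR h) (Finset.mem_insert_of_mem hi)

variable [Fintype V]

/-- Values at nodes of the path are stored when the path is extended, so cutting the path back
restores them. -/
theorem pathValue_cutBack (G : WeightedGraph V) (q : ℝ) (s : V → ℝ) (U : Finset V) {γ : List V}
    (hγ : γ.Nodup) {y : V} (hy : y ∈ γ) :
    pathValue G q s U (y :: (γ.takeWhile (fun z => decide (z ≠ y))).reverse) y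
      = pathValue G q s U γ.reverse y := by
  obtain ⟨r, hr⟩ := exists_eq_takeWhile_ne_append hy
  have hyr : y ∉ r := by
    rw [hr] at hγ
    exact (List.nodup_cons.1 (List.nodup_append.1 hγ).2.1).1
  conv_rhs => rw [hr, List.reverse_append, List.reverse_cons, List.append_assoc,
    pathValue_append _ _ _ _ _ (by simpa using hyr)]
  rfl

/-- The conditional expectation of `∏ i ∉ 𝒴, s i` given the covered set `U`, the recorded set `R`
and the loop erasure of the walk in progress, in reverse order. -/
noncomputable def reducedValue (G : WeightedGraph V) (q : ℝ) (s : V → ℝ) (U R : Finset V) :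
    List V → ℝ
  | [] => rootWeight s U R * ((maskRows (tiltedMatrix G q s) Uᶜ).det
      / (maskRows (tiltedMatrix G q 1) Uᶜ).det)
  | x :: l => rootWeight s U R * pathValue G q s U (x :: l) x

/-- The conditional expectation of `∏ i ∉ 𝒴, s i` given the state of the algorithm. -/
noncomputable def stateValue (G : WeightedGraph V) (q : ℝ) (s : V → ℝ) (st : WilsonState V) : ℝ :=
  reducedValue G q s st.visited st.roots (loopErase st.current).reverse

/-- Being loop-erased, the walk in progress leaves only finitely many possible values. -/
theorem exists_abs_stateValue_le (G : WeightedGraph V) (q : ℝ) (s : V → ℝ) :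
    ∃ c, ∀ st, |stateValue G q s st| ≤ c := by
  obtain ⟨c, hc⟩ := Finite.exists_le (fun a : Finset V × Finset V × {l : List V // l.Nodup} =>
    |reducedValue G q s a.1 a.2.1 a.2.2|)
  exact ⟨c, fun st => hc (st.visited, st.roots, ⟨(loopErase st.current).reverse,
    List.nodup_reverse.2 (loopErase_nodup _)⟩)⟩

/-- The choice of the starting node is irrelevant, so no start rule affects the output law. -/
theorem stateValue_start (G : WeightedGraph V) (q : ℝ) (s : V → ℝ) {st : WilsonState V}
    (h : st.current = []) (i : V) :
    stateValue G q s { st with current := [i] } = stateValue G q s st := by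
  have h1 : (loopErase [i]).reverse = [i] := by simp [loopErase]
  have h2 : (loopErase st.current).reverse = [] := by simp [loopErase, h]
  rw [stateValue, stateValue, h1, h2, reducedValue, reducedValue, pathValue_singleton]

/-- `stateValue` is harmonic for the jumps of the walk. -/
theorem stateValue_move (G : WeightedGraph V) {q : ℝ} (hq : 0 < q) (s : V → ℝ)
    {st : WilsonState V} (hst : st.Consistent) {x : V} (hx : st.current.getLast? = some x) :
    (G.degree x + q) * stateValue G q s st = q * stateValue G q s (st.move x none)
      + ∑ y, G.W x y * stateValue G q s (st.move x (some y)) := by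
  obtain ⟨U, R, cur, past⟩ := st
  obtain ⟨hR, hcur⟩ := hst
  obtain ⟨t, rfl⟩ := List.getLast?_eq_some_iff.1 hx
  simp only at hR hcur
  set γ := loopErase (t ++ [x]) with hγdef
  have hγ : γ.Nodup := loopErase_nodup _
  have hγU : ∀ y ∈ γ, y ∉ U := fun y hy => hcur y (loopErase_subset _ y hy)
  obtain ⟨l, hl⟩ : ∃ l, γ.reverse = x :: l :=
    ⟨_, by rw [hγdef, loopErase_append_singleton, List.reverse_append]; rfl⟩
  have hmem : ∀ y, y ∈ x :: l ↔ y ∈ γ := fun y => by rw [← hl, List.mem_reverse]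
  have hxl : x ∉ l := by
    have := List.nodup_reverse.2 hγ
    rw [hl] at this
    exact (List.nodup_cons.1 this).1
  have hfin : γ.toFinset = insert x l.toFinset := by
    rw [← List.toFinset_reverse, hl, List.toFinset_cons]
  have hdisj : Disjoint U (insert x l.toFinset) := by
    rw [← hfin, Finset.disjoint_right]
    exact fun y hy => hγU y (List.mem_toFinset.1 hy)
  have hharm := pathValue_harmonic G hq s U x l (hγU x ((hmem x).1 (by simp))) hxl
    (fun y hy => hγU y ((hmem y).1 (List.mem_cons_of_mem x hy)))
  have e0 : stateValue G q s ⟨U, R, t ++ [x], past⟩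
      = rootWeight s U R * pathValue G q s U (x :: l) x := by
    rw [stateValue]; simp only [← hγdef, hl, reducedValue]
  have e1 : stateValue G q s (WilsonState.move ⟨U, R, t ++ [x], past⟩ x none)
      = rootWeight s U R * ((∏ i ∈ l.toFinset, s i)
        * ((maskRows (tiltedMatrix G q s) (U ∪ (x :: l).toFinset)ᶜ).det
          / (maskRows (tiltedMatrix G q 1) (U ∪ (x :: l).toFinset)ᶜ).det)) := by
    rw [stateValue]
    simp only [WilsonState.move, ← hγdef, hfin]
    rw [show (loopErase ([] : List V)).reverse = [] from rfl, reducedValue,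
      rootWeight_union_insert hR hdisj (by simpa using hxl), List.toFinset_cons, mul_assoc]
  have e2 : ∀ y, stateValue G q s (WilsonState.move ⟨U, R, t ++ [x], past⟩ x (some y))
      = rootWeight s U R * (if y ∈ U then (∏ i ∈ (x :: l).toFinset, s i)
            * ((maskRows (tiltedMatrix G q s) (U ∪ (x :: l).toFinset)ᶜ).det
              / (maskRows (tiltedMatrix G q 1) (U ∪ (x :: l).toFinset)ᶜ).det)
          else if y ∈ x :: l then pathValue G q s U (x :: l) y
          else pathValue G q s U (y :: x :: l) y) := by
    intro y
    rw [stateValue]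
    by_cases hyU : y ∈ U
    · simp only [WilsonState.move, ← hγdef, hfin, hyU, if_true]
      rw [show (loopErase ([] : List V)).reverse = [] from rfl, reducedValue,
        rootWeight_union hR hdisj, List.toFinset_cons, mul_assoc]
    · simp only [WilsonState.move, hyU, if_false]
      rw [loopErase_append_singleton, ← hγdef, List.reverse_append, List.reverse_singleton,
        List.singleton_append, reducedValue]
      by_cases hyl : y ∈ x :: l
      · rw [if_pos hyl, pathValue_cutBack G q s U hγ ((hmem y).1 hyl), hl]
      · rw [if_neg hyl, takeWhile_ne_of_notMem (fun h => hyl ((hmem y).2 h)), hl]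
  rw [e0, e1]
  simp only [e2]
  rw [mul_left_comm, hharm, mul_add, Finset.mul_sum]
  congr 1
  · ring
  · exact Finset.sum_congr rfl fun y _ => by ring

theorem stateValue_of_visited_eq_univ (G : WeightedGraph V) (q : ℝ) (S : Finset V)
    {st : WilsonState V} (hst : st.Consistent) (h : st.visited = Finset.univ) :
    stateValue G q (fun i => if i ∈ S then 0 else 1) st = if S ⊆ st.roots then 1 else 0 := by
  rw [stateValue, hst.current_eq_nil h, h, show (loopErase ([] : List V)).reverse = [] from rfl,
    reducedValue, Finset.compl_univ, det_maskRows_empty, det_maskRows_empty, div_one, mul_one,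
    rootWeight]
  split_ifs with hS
  · refine Finset.prod_eq_one fun i _ => ?_
    by_cases hi : i ∈ S
    · simp [hS hi]
    · simp [hi]
  · obtain ⟨i, hi, hiR⟩ := Finset.not_subset.1 hS
    exact Finset.prod_eq_zero (Finset.mem_univ i) (by simp [hi, hiR])

theorem stateValue_init (G : WeightedGraph V) (q : ℝ) (s : V → ℝ) :
    stateValue G q s WilsonState.init
      = (tiltedMatrix G q s).det / (tiltedMatrix G q 1).det := by
  rw [stateValue, WilsonState.init, show (loopErase ([] : List V)).reverse = [] from rfl,
    reducedValue, Finset.compl_empty, maskRows_univ, maskRows_univ]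
  simp [rootWeight]

end StateValue

/-! ### Expectations with respect to probability mass functions -/

namespace PMF

/-- The expectation of a function with values in `[0, ∞]`. -/
noncomputable def expect {α : Type*} (p : PMF α) (f : α → ℝ≥0∞) : ℝ≥0∞ := ∑' a, p a * f a

variable {α β : Type*}

theorem expect_pure (a : α) (f : α → ℝ≥0∞) : (PMF.pure a).expect f = f a := by
  rw [expect, tsum_eq_single a]
  · simp
  · intro b hb; simp [hb]

theorem expect_bind (p : PMF α) (k : α → PMF β) (f : β → ℝ≥0∞) :
    (p.bind k).expect f = p.expect fun a => (k a).expect f := by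
  simp only [expect, PMF.bind_apply, ← ENNReal.tsum_mul_right, ← ENNReal.tsum_mul_left]
  rw [ENNReal.tsum_comm]
  simp only [mul_assoc]

theorem expect_map (p : PMF α) (k : α → β) (f : β → ℝ≥0∞) :
    (p.map k).expect f = p.expect fun a => f (k a) := by
  rw [← PMF.bind_pure_comp, expect_bind]
  simp [expect_pure]

theorem expect_congr (p : PMF α) {f g : α → ℝ≥0∞} (h : ∀ a ∈ p.support, f a = g a) :
    p.expect f = p.expect g :=
  tsum_congr fun a => by
    by_cases ha : a ∈ p.support
    · rw [h a ha]
    · rw [(p.apply_eq_zero_iff a).2 ha, zero_mul, zero_mul]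

theorem expect_mono (p : PMF α) {f g : α → ℝ≥0∞} (h : ∀ a ∈ p.support, f a ≤ g a) :
    p.expect f ≤ p.expect g :=
  ENNReal.tsum_le_tsum fun a => by
    by_cases ha : a ∈ p.support
    · gcongr; exact h a ha
    · rw [(p.apply_eq_zero_iff a).2 ha, zero_mul, zero_mul]

theorem expect_add (p : PMF α) (f g : α → ℝ≥0∞) :
    p.expect (fun a => f a + g a) = p.expect f + p.expect g := by
  simp only [expect, mul_add]
  exact ENNReal.tsum_add

theorem expect_const_mul (p : PMF α) (c : ℝ≥0∞) (f : α → ℝ≥0∞) :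
    p.expect (fun a => c * f a) = c * p.expect f := by
  simp only [expect, mul_left_comm _ c]
  exact ENNReal.tsum_mul_left

theorem expect_const (p : PMF α) (c : ℝ≥0∞) : p.expect (fun _ => c) = c := by
  rw [expect, ENNReal.tsum_mul_right, p.tsum_coe, one_mul]

theorem expect_finset_sum {ι : Type*} (p : PMF α) (s : Finset ι) (f : ι → α → ℝ≥0∞) :
    p.expect (fun a => ∑ i ∈ s, f i a) = ∑ i ∈ s, p.expect (f i) := by
  simp only [expect, Finset.mul_sum]
  exact Summable.tsum_finsetSum fun _ _ => ENNReal.summable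

theorem toOuterMeasure_eq_expect (p : PMF α) (s : Set α) :
    p.toOuterMeasure s = p.expect (s.indicator 1) := by
  rw [PMF.toOuterMeasure_apply, expect]
  exact tsum_congr fun a => by by_cases ha : a ∈ s <;> simp [ha]

end PMF

/-! ### Invariants and termination of Wilson's algorithm -/

section Run

theorem expect_jump {V : Type*} [Fintype V] (G : WeightedGraph V) {q : ℝ} (hq : 0 < q) (x : V)
    {f : Option V → ℝ} (hf : ∀ y, 0 ≤ f y) :
    (G.jump hq x).expect (fun y => ENNReal.ofReal (f y))
      = ENNReal.ofReal ((q * f none + ∑ y, G.W x y * f (some y)) / (G.degree x + q)) := by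
  have hd : 0 < G.degree x + q := add_pos_of_nonneg_of_pos (G.degree_nonneg x) hq
  have hj : ∀ y, 0 ≤ G.jumpProb q x y := by
    rintro (_ | j)
    · exact div_nonneg hq.le hd.le
    · exact div_nonneg (G.nonneg x j) hd.le
  rw [PMF.expect, tsum_fintype]
  simp only [WeightedGraph.jump, PMF.ofFintype_apply, ← ENNReal.ofReal_mul (hj _)]
  rw [← ENNReal.ofReal_sum_of_nonneg fun y _ => mul_nonneg (hj y) (hf y), Fintype.sum_option,
    add_div, Finset.sum_div]
  simp only [WeightedGraph.jumpProb, div_mul_eq_mul_div]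

variable {V : Type*} [Fintype V] [DecidableEq V] (G : WeightedGraph V) {q : ℝ} (hq : 0 < q)
  (rule : WilsonState V → PMF V)

theorem wilsonStep_of_visited_eq_univ {st : WilsonState V} (h : st.visited = Finset.univ) :
    wilsonStep G hq rule st = PMF.pure st := if_pos h

theorem wilsonStep_start {st : WilsonState V} (h : st.visited ≠ Finset.univ)
    (hc : st.current = []) :
    wilsonStep G hq rule st = (rule st).map fun i => { st with current := [i] } := by
  rw [wilsonStep, if_neg h]
  simp [hc]

theorem wilsonStep_jump {st : WilsonState V} (h : st.visited ≠ Finset.univ) {x : V}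
    (hx : st.current.getLast? = some x) :
    wilsonStep G hq rule st = (G.jump hq x).map (st.move x) := by
  rw [wilsonStep, if_neg h]
  simp [hx]

variable {rule} in
theorem WilsonState.Consistent.of_mem_support_wilsonStep (hrule : IsStartRule rule)
    {st st' : WilsonState V} (hst : st.Consistent)
    (h : st' ∈ (wilsonStep G hq rule st).support) : st'.Consistent := by
  by_cases hu : st.visited = Finset.univ
  · rw [wilsonStep_of_visited_eq_univ G hq rule hu, PMF.support_pure, Set.mem_singleton_iff] at h
    exact h ▸ hst
  rcases hl : st.current.getLast? with _ | x
  · rw [List.getLast?_eq_none_iff] at hl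
    rw [wilsonStep_start G hq rule hu hl, PMF.mem_support_map_iff] at h
    obtain ⟨i, hi, rfl⟩ := h
    refine ⟨hst.1, fun v hv => ?_⟩
    rw [List.mem_singleton] at hv
    exact hv ▸ hrule st hu i hi
  · rw [wilsonStep_jump G hq rule hu hl, PMF.mem_support_map_iff] at h
    obtain ⟨y, -, rfl⟩ := h
    have hx : x ∈ loopErase st.current := by
      obtain ⟨t, ht⟩ := List.getLast?_eq_some_iff.1 hl
      rw [ht, loopErase_append_singleton]; simp
    rcases y with _ | j
    · refine ⟨?_, by simp [WilsonState.move]⟩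
      refine Finset.insert_subset ?_ (hst.1.trans Finset.subset_union_left)
      exact Finset.mem_union_right _ (List.mem_toFinset.2 hx)
    · by_cases hj : j ∈ st.visited
      · simp only [WilsonState.move, hj, if_true]
        exact ⟨hst.1.trans Finset.subset_union_left, by simp⟩
      · simp only [WilsonState.move, hj, if_false]
        refine ⟨hst.1, fun v hv => ?_⟩
        rcases List.mem_append.1 hv with hv | hv
        · exact hst.2 v hv
        · rw [List.mem_singleton] at hv; exact hv ▸ hj

variable {rule} in
theorem consistent_of_mem_support_wilsonRun (hrule : IsStartRule rule) :
    ∀ (n : ℕ), ∀ st ∈ (wilsonRun G hq rule n).support, st.Consistent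
  | 0, st, h => by
    rw [wilsonRun, PMF.support_pure, Set.mem_singleton_iff] at h
    subst h
    exact ⟨Finset.Subset.refl _, by simp [WilsonState.init]⟩
  | n + 1, st, h => by
    rw [wilsonRun, PMF.mem_support_bind_iff] at h
    obtain ⟨st', h', h⟩ := h
    exact (consistent_of_mem_support_wilsonRun hrule n st' h').of_mem_support_wilsonStep
      G hq hrule h

variable {rule} in
theorem expect_wilsonStep_stateValue (s : V → ℝ) {c : ℝ} (hc : ∀ st, |stateValue G q s st| ≤ c)
    {st : WilsonState V} (hst : st.Consistent) :
    (wilsonStep G hq rule st).expect (fun st => ENNReal.ofReal (stateValue G q s st + c))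
      = ENNReal.ofReal (stateValue G q s st + c) := by
  by_cases hu : st.visited = Finset.univ
  · rw [wilsonStep_of_visited_eq_univ G hq rule hu, PMF.expect_pure]
  rcases hl : st.current.getLast? with _ | x
  · rw [List.getLast?_eq_none_iff] at hl
    rw [wilsonStep_start G hq rule hu hl, PMF.expect_map]
    simp only [stateValue_start G q s hl, PMF.expect_const]
  · have hd : 0 < G.degree x + q := add_pos_of_nonneg_of_pos (G.degree_nonneg x) hq
    rw [wilsonStep_jump G hq rule hu hl, PMF.expect_map,
      expect_jump G hq x (f := fun y => stateValue G q s (st.move x y) + c)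
        (fun y => by linarith [neg_le_of_abs_le (hc (st.move x y))])]
    congr 1
    rw [div_eq_iff hd.ne']
    simp only [mul_add, Finset.sum_add_distrib, ← Finset.sum_mul]
    have := stateValue_move G hq s hst hl
    rw [show ∑ i, G.W x i = G.degree x from rfl]
    linear_combination -this

variable {rule} in
/-- `stateValue` is a martingale along the run; the shift by `c` makes it nonnegative. -/
theorem expect_wilsonRun_stateValue (hrule : IsStartRule rule) (s : V → ℝ) {c : ℝ}
    (hc : ∀ st, |stateValue G q s st| ≤ c) : ∀ n : ℕ,
    (wilsonRun G hq rule n).expect (fun st => ENNReal.ofReal (stateValue G q s st + c))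
      = ENNReal.ofReal (stateValue G q s WilsonState.init + c)
  | 0 => by rw [wilsonRun, PMF.expect_pure]
  | n + 1 => by
    rw [wilsonRun, PMF.expect_bind, ← expect_wilsonRun_stateValue hrule s hc n]
    exact PMF.expect_congr _ fun st hst => expect_wilsonStep_stateValue G hq s hc
      (consistent_of_mem_support_wilsonRun G hq hrule n st hst)

/-- An upper bound for the expected number of steps that are left: a jump covers a new node with
probability at least `q / ∑ i, (D i i + q)`, and every walk has one step that starts it. -/
noncomputable def remainingSteps (q : ℝ) (st : WilsonState V) : ℝ :=
  (1 + (∑ i, (G.degree i + q)) / q) * (st.visitedᶜ.card : ℝ) + if st.current = [] then 1 else 0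

theorem remainingSteps_nonneg (hq : 0 < q) (st : WilsonState V) : 0 ≤ remainingSteps G q st := by
  have : 0 ≤ ∑ i, (G.degree i + q) :=
    Finset.sum_nonneg fun i _ => add_nonneg (G.degree_nonneg i) hq.le
  unfold remainingSteps
  positivity

variable {rule} in
/-- Until termination, every step lowers `remainingSteps` by at least `1` in expectation. -/
theorem expect_wilsonStep_remainingSteps {st : WilsonState V} (hst : st.Consistent) :
    (wilsonStep G hq rule st).expect (fun st => ENNReal.ofReal (remainingSteps G q st))
      + {st : WilsonState V | st.visited ≠ Finset.univ}.indicator 1 st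
      ≤ ENNReal.ofReal (remainingSteps G q st) := by
  by_cases hu : st.visited = Finset.univ
  · rw [wilsonStep_of_visited_eq_univ G hq rule hu, PMF.expect_pure]
    simp [hu]
  rw [Set.indicator_of_mem (by exact hu), Pi.one_apply]
  rcases hl : st.current.getLast? with _ | x
  · rw [List.getLast?_eq_none_iff] at hl
    rw [wilsonStep_start G hq rule hu hl, PMF.expect_map]
    have hD : 0 ≤ ∑ i, (G.degree i + q) :=
      Finset.sum_nonneg fun i _ => add_nonneg (G.degree_nonneg i) hq.le
    simp only [remainingSteps, List.cons_ne_nil, if_false, add_zero, PMF.expect_const, hl, if_true]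
    rw [ENNReal.ofReal_add (by positivity) zero_le_one, ENNReal.ofReal_one]
  · have hne : st.current ≠ [] := by rintro e; simp [e] at hl
    have hd : 0 < G.degree x + q := add_pos_of_nonneg_of_pos (G.degree_nonneg x) hq
    have hx : x ∈ loopErase st.current := by
      obtain ⟨t, ht⟩ := List.getLast?_eq_some_iff.1 hl
      rw [ht, loopErase_append_singleton]; simp
    have hxU : x ∉ st.visited := hst.2 x (loopErase_subset _ x hx)
    have hcard : ((st.visited ∪ (loopErase st.current).toFinset)ᶜ.card : ℝ) + 1
        ≤ st.visitedᶜ.card := by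
      norm_cast
      refine Finset.card_lt_card (Finset.ssubset_iff_of_subset ?_ |>.2 ⟨x, ?_, ?_⟩)
      · exact Finset.compl_subset_compl.2 Finset.subset_union_left
      · simpa using hxU
      · simp [hx]
    set D := ∑ i, (G.degree i + q) with hD
    have hxD : G.degree x + q ≤ D := Finset.single_le_sum
      (f := fun i => G.degree i + q) (fun i _ => add_nonneg (G.degree_nonneg i) hq.le)
      (Finset.mem_univ x)
    set a := 1 + D / q with ha
    have hD0 : 0 ≤ D := hd.le.trans hxD
    have ha1 : 1 ≤ a := le_add_of_nonneg_right (div_nonneg hD0 hq.le)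
    have hqa : q * (a - 1) = D := by rw [ha]; field_simp; ring
    have hst0 : remainingSteps G q st = a * (st.visitedᶜ.card : ℝ) := by
      simp [remainingSteps, hne, ha, hD]
    have hcover : a * ((st.visited ∪ (loopErase st.current).toFinset)ᶜ.card : ℝ) + 1
        ≤ a * (st.visitedᶜ.card : ℝ) - (a - 1) := by nlinarith
    have hnone : remainingSteps G q (st.move x none) ≤ a * (st.visitedᶜ.card : ℝ) - (a - 1) := by
      refine le_trans (le_of_eq ?_) hcover
      simp [remainingSteps, WilsonState.move, ha, hD]
    have hsome : ∀ y, remainingSteps G q (st.move x (some y)) ≤ a * (st.visitedᶜ.card : ℝ) := by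
      intro y
      by_cases hy : y ∈ st.visited
      · refine le_trans (le_of_eq ?_) (hcover.trans (by linarith))
        simp [remainingSteps, WilsonState.move, ha, hD, hy]
      · simp [remainingSteps, WilsonState.move, ha, hD, hy]
    rw [wilsonStep_jump G hq rule hu hl, PMF.expect_map,
      expect_jump G hq x (f := fun y => remainingSteps G q (st.move x y))
        (fun y => remainingSteps_nonneg G hq _), ← ENNReal.ofReal_one,
      ← ENNReal.ofReal_add _ zero_le_one, hst0]
    · apply ENNReal.ofReal_le_ofReal
      rw [← le_sub_iff_add_le, div_le_iff₀ hd]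
      have h1 : ∑ y, G.W x y * remainingSteps G q (st.move x (some y))
          ≤ G.degree x * (a * (st.visitedᶜ.card : ℝ)) := by
        rw [WeightedGraph.degree, Finset.sum_mul]
        exact Finset.sum_le_sum fun y _ => mul_le_mul_of_nonneg_left (hsome y) (G.nonneg x y)
      have h2 := mul_le_mul_of_nonneg_left hnone hq.le
      linarith
    · refine div_nonneg (add_nonneg (mul_nonneg hq.le (remainingSteps_nonneg G hq _)) ?_) hd.le
      exact Finset.sum_nonneg fun y _ => mul_nonneg (G.nonneg x y) (remainingSteps_nonneg G hq _)

variable {rule} in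
theorem sum_expect_not_terminated_le (hrule : IsStartRule rule) : ∀ n : ℕ,
    (wilsonRun G hq rule n).expect (fun st => ENNReal.ofReal (remainingSteps G q st))
      + ∑ k ∈ Finset.range n, (wilsonRun G hq rule k).expect
        ({st : WilsonState V | st.visited ≠ Finset.univ}.indicator 1)
      ≤ ENNReal.ofReal (remainingSteps G q WilsonState.init)
  | 0 => by simp [wilsonRun, PMF.expect_pure]
  | n + 1 => by
    refine le_trans ?_ (sum_expect_not_terminated_le hrule n)
    rw [Finset.sum_range_succ, add_comm (∑ k ∈ _, _), ← add_assoc]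
    gcongr
    rw [wilsonRun, PMF.expect_bind, ← PMF.expect_add]
    exact PMF.expect_mono _ fun st hst => expect_wilsonStep_remainingSteps G hq
      (consistent_of_mem_support_wilsonRun G hq hrule n st hst)

variable {rule} in
theorem tendsto_expect_not_terminated (hrule : IsStartRule rule) :
    Tendsto (fun n => (wilsonRun G hq rule n).expect
      ({st : WilsonState V | st.visited ≠ Finset.univ}.indicator 1)) atTop (𝓝 0) := by
  apply ENNReal.tendsto_atTop_zero_of_tsum_ne_top
  refine ne_top_of_le_ne_top (ENNReal.ofReal_ne_top
    (r := remainingSteps G q (WilsonState.init : WilsonState V))) ?_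
  rw [ENNReal.tsum_eq_iSup_nat]
  exact iSup_le fun n => le_trans le_add_self (sum_expect_not_terminated_le G hq hrule n)

end Run

/-! ### The law of the output -/

section OutputLaw

variable {V : Type*} [Fintype V] [DecidableEq V]

theorem wilsonRun_terminated_mono (G : WeightedGraph V) {q : ℝ} (hq : 0 < q)
    (rule : WilsonState V → PMF V) (A : Finset V) :
    Monotone fun n => (wilsonRun G hq rule n).toOuterMeasure
      {s | s.visited = Finset.univ ∧ s.roots = A} := by
  refine monotone_nat_of_le_succ fun n => ?_
  rw [PMF.toOuterMeasure_eq_expect, PMF.toOuterMeasure_eq_expect, wilsonRun, PMF.expect_bind]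
  refine PMF.expect_mono _ fun st _ => ?_
  by_cases h : st.visited = Finset.univ
  · rw [wilsonStep_of_visited_eq_univ G hq rule h, PMF.expect_pure]
  · rw [Set.indicator_of_notMem fun h' => h h'.1]
    exact zero_le

/-- The probability of having terminated with an output satisfying `P` is the sum of the
probabilities of the individual outputs. -/
theorem sum_toOuterMeasure_terminated (p : PMF (WilsonState V)) (P : Finset V → Prop)
    [DecidablePred P] :
    ∑ A with P A, p.toOuterMeasure {s | s.visited = Finset.univ ∧ s.roots = A}
      = p.expect ({s | s.visited = Finset.univ ∧ P s.roots}.indicator 1) := by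
  simp only [PMF.toOuterMeasure_eq_expect]
  rw [← PMF.expect_finset_sum]
  refine PMF.expect_congr _ fun st _ => ?_
  by_cases h : st.visited = Finset.univ <;> simp [Set.indicator_apply, h]

theorem exists_isWilsonOutputLaw (G : WeightedGraph V) {q : ℝ} (hq : 0 < q)
    {rule : WilsonState V → PMF V} (hrule : IsStartRule rule) :
    ∃ p : PMF (Finset V), IsWilsonOutputLaw G hq rule p := by
  set f : Finset V → ℝ≥0∞ := fun A => ⨆ n, (wilsonRun G hq rule n).toOuterMeasure
      {s | s.visited = Finset.univ ∧ s.roots = A} with hf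
  have hlim : ∀ A, Tendsto (fun n => (wilsonRun G hq rule n).toOuterMeasure
      {s | s.visited = Finset.univ ∧ s.roots = A}) atTop (𝓝 (f A)) := fun A =>
    tendsto_atTop_iSup (wilsonRun_terminated_mono G hq rule A)
  refine ⟨PMF.ofFintype f ?_, hlim⟩
  have h1 := (tendsto_finsetSum Finset.univ fun A _ => hlim A).add
    (tendsto_expect_not_terminated G hq hrule)
  have h2 : ∀ n, ∑ A, (wilsonRun G hq rule n).toOuterMeasure
      {s | s.visited = Finset.univ ∧ s.roots = A}
      + (wilsonRun G hq rule n).expect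
        ({st : WilsonState V | st.visited ≠ Finset.univ}.indicator 1) = 1 := by
    intro n
    have := sum_toOuterMeasure_terminated (wilsonRun G hq rule n) (fun _ => True)
    rw [Finset.filter_true] at this
    rw [this, ← PMF.expect_add, ← PMF.expect_const (wilsonRun G hq rule n) 1]
    refine PMF.expect_congr _ fun st _ => ?_
    by_cases h : st.visited = Finset.univ <;> simp [h]
  simp only [h2, add_zero] at h1
  exact tendsto_nhds_unique h1 tendsto_const_nhds

/-- Optional stopping for `stateValue`: the probability that `S` is contained in the output is the
value of the initial state, for the weights `s` that vanish on `S` and are `1` elsewhere, because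
`∏ i ∉ 𝒴, s i` is then the indicator of `S ⊆ 𝒴`. -/
theorem IsWilsonOutputLaw.toOuterMeasure_subset {G : WeightedGraph V} {q : ℝ} {hq : 0 < q}
    {rule : WilsonState V → PMF V} (hrule : IsStartRule rule) {p : PMF (Finset V)}
    (hp : IsWilsonOutputLaw G hq rule p) (S : Finset V) :
    (p.toOuterMeasure {A | S ⊆ A}).toReal
      = (tiltedMatrix G q fun i => if i ∈ S then 0 else 1).det / (tiltedMatrix G q 1).det := by
  set s : V → ℝ := fun i => if i ∈ S then 0 else 1 with hs
  obtain ⟨c, hc⟩ := exists_abs_stateValue_le G q s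
  have hc0 : 0 ≤ c := (abs_nonneg _).trans (hc WilsonState.init)
  set T : Set (WilsonState V) := {st | st.visited = Finset.univ ∧ S ⊆ st.roots} with hT
  set N : Set (WilsonState V) := {st | st.visited ≠ Finset.univ} with hN
  set a : ℝ≥0∞ := p.toOuterMeasure {A | S ⊆ A} with ha
  have hlim : Tendsto (fun n => (wilsonRun G hq rule n).expect (T.indicator 1)) atTop (𝓝 a) := by
    have h1 := tendsto_finsetSum ({A | S ⊆ A} : Finset (Finset V)) fun A _ => hp A
    simp only [sum_toOuterMeasure_terminated] at h1
    rwa [← PMF.toOuterMeasure_apply_finset, Finset.coe_filter_univ] at h1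
  have hN0 := tendsto_expect_not_terminated G hq hrule
  set v : ℝ≥0∞ := ENNReal.ofReal (stateValue G q s WilsonState.init + c) with hv
  set K : ℝ≥0∞ := ENNReal.ofReal (2 * c) with hK
  -- Up to a multiple of the indicator of not having terminated, the harmonic function agrees
  -- with the indicator of `S ⊆ 𝒴`; the constant `c` makes it nonnegative.
  have hval : ∀ st : WilsonState V, st.Consistent → st.visited = Finset.univ →
      ENNReal.ofReal (stateValue G q s st + c) = T.indicator 1 st + ENNReal.ofReal c := by
    intro st hst h
    rw [hs, stateValue_of_visited_eq_univ G q S hst h]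
    by_cases hS : S ⊆ st.roots
    · rw [if_pos hS, Set.indicator_of_mem (show st ∈ T from ⟨h, hS⟩),
        ENNReal.ofReal_add zero_le_one hc0, ENNReal.ofReal_one, Pi.one_apply]
    · rw [if_neg hS, Set.indicator_of_notMem fun h' => hS h'.2, zero_add, zero_add]
  have hupper : ∀ n, v ≤ (wilsonRun G hq rule n).expect (T.indicator 1) + ENNReal.ofReal c
      + K * (wilsonRun G hq rule n).expect (N.indicator 1) := by
    intro n
    rw [hv, ← expect_wilsonRun_stateValue G hq hrule s hc n, ← PMF.expect_const_mul,
      ← PMF.expect_const (wilsonRun G hq rule n) (ENNReal.ofReal c), ← PMF.expect_add,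
      ← PMF.expect_add]
    refine PMF.expect_mono _ fun st hst => ?_
    have hst := consistent_of_mem_support_wilsonRun G hq hrule n st hst
    by_cases h : st.visited = Finset.univ
    · rw [hval st hst h]; exact le_self_add
    · rw [Set.indicator_of_mem (show st ∈ N from h), Pi.one_apply, mul_one]
      refine le_trans (ENNReal.ofReal_le_ofReal ?_) le_add_self
      linarith [le_of_abs_le (hc st)]
  have hlower : ∀ n, (wilsonRun G hq rule n).expect (T.indicator 1) + ENNReal.ofReal c
      ≤ v + ENNReal.ofReal c * (wilsonRun G hq rule n).expect (N.indicator 1) := by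
    intro n
    rw [hv, ← expect_wilsonRun_stateValue G hq hrule s hc n, ← PMF.expect_const_mul,
      ← PMF.expect_const (wilsonRun G hq rule n) (ENNReal.ofReal c), ← PMF.expect_add,
      ← PMF.expect_add, PMF.expect_const]
    refine PMF.expect_mono _ fun st hst => ?_
    have hst := consistent_of_mem_support_wilsonRun G hq hrule n st hst
    by_cases h : st.visited = Finset.univ
    · rw [hval st hst h]; exact le_self_add
    · rw [Set.indicator_of_mem (show st ∈ N from h), Pi.one_apply, mul_one,
        Set.indicator_of_notMem fun h' => h h'.1, zero_add]
      exact le_add_self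
  have h1 : v ≤ a + ENNReal.ofReal c + K * 0 :=
    ge_of_tendsto' ((hlim.add tendsto_const_nhds).add
      (ENNReal.Tendsto.const_mul hN0 (Or.inr ENNReal.ofReal_ne_top))) hupper
  have h2 : a + ENNReal.ofReal c ≤ v + ENNReal.ofReal c * 0 :=
    le_of_tendsto_of_tendsto' (hlim.add tendsto_const_nhds) (tendsto_const_nhds.add
      (ENNReal.Tendsto.const_mul hN0 (Or.inr ENNReal.ofReal_ne_top))) hlower
  rw [mul_zero, add_zero] at h1 h2
  have h3 := congrArg ENNReal.toReal (le_antisymm h1 h2)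
  have hatop : a ≠ ⊤ := fun h => by
    rw [h, top_add, top_le_iff] at h2
    exact ENNReal.ofReal_ne_top h2
  rw [ENNReal.toReal_add hatop ENNReal.ofReal_ne_top, ENNReal.toReal_ofReal hc0,
    ENNReal.toReal_ofReal (by linarith [neg_le_of_abs_le (hc WilsonState.init)]),
    stateValue_init] at h3
  linarith

end OutputLaw

/-! ### The marginal kernel -/

section Kernel

variable {V : Type*} [Fintype V] [DecidableEq V]

theorem isUnit_laplacian_add (G : WeightedGraph V) {q : ℝ} (hq : 0 < q) :
    IsUnit (G.laplacian + q • (1 : Matrix V V ℝ)) := by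
  have := det_maskRows_tiltedMatrix_one_ne_zero G hq Finset.univ
  rw [maskRows_univ, tiltedMatrix_one] at this
  rw [Matrix.isUnit_iff_isUnit_det]
  exact this.isUnit

theorem laplacian_isHermitian (G : WeightedGraph V) : G.laplacian.IsHermitian := by
  ext i j
  by_cases h : i = j
  · subst h; simp
  · simp [WeightedGraph.laplacian, h, Ne.symm h, G.symm i j]

theorem laplacian_posSemidef (G : WeightedGraph V) : G.laplacian.PosSemidef := by
  refine Matrix.PosSemidef.of_dotProduct_mulVec_nonneg (laplacian_isHermitian G) fun f => ?_
  have key : 2 * (star f ⬝ᵥ G.laplacian *ᵥ f)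
      = ∑ i, ∑ j, G.W i j * (f i - f j) ^ 2 := by
    have h1 : star f ⬝ᵥ G.laplacian *ᵥ f
        = ∑ i, ∑ j, G.W i j * (f i * (f i - f j)) := by
      refine Finset.sum_congr rfl fun i _ => ?_
      rw [laplacian_mulVec_apply, WeightedGraph.degree, Finset.sum_mul, ← Finset.sum_sub_distrib,
        Finset.mul_sum]
      exact Finset.sum_congr rfl fun j _ => by simp only [star_trivial]; ring
    have h2 : star f ⬝ᵥ G.laplacian *ᵥ f
        = ∑ i, ∑ j, G.W i j * (f j * (f j - f i)) := by
      rw [h1, Finset.sum_comm]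
      exact Finset.sum_congr rfl fun i _ => Finset.sum_congr rfl fun j _ => by rw [G.symm]
    rw [two_mul]
    nth_rewrite 1 [h1]
    rw [h2, ← Finset.sum_add_distrib]
    refine Finset.sum_congr rfl fun i _ => ?_
    rw [← Finset.sum_add_distrib]
    exact Finset.sum_congr rfl fun j _ => by ring
  have : 0 ≤ ∑ i, ∑ j, G.W i j * (f i - f j) ^ 2 :=
    Finset.sum_nonneg fun i _ => Finset.sum_nonneg fun j _ =>
      mul_nonneg (G.nonneg i j) (sq_nonneg _)
  linarith

theorem laplacian_add_posSemidef (G : WeightedGraph V) {q : ℝ} (hq : 0 < q) :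
    (G.laplacian + q • (1 : Matrix V V ℝ)).PosSemidef :=
  (laplacian_posSemidef G).add (Matrix.PosSemidef.one.smul hq.le)

/-- The marginals of the kernel `q (L + q)⁻¹`: multiplying `diag(s) L + q`, where `s` vanishes on
`S` and is `1` elsewhere, by the inverse of `L + q` turns the rows in `S` into those of the kernel
and the other rows into those of the identity. -/
theorem det_tiltedMatrix_div (G : WeightedGraph V) {q : ℝ} (hq : 0 < q) (S : Finset V) :
    (tiltedMatrix G q fun i => if i ∈ S then 0 else 1).det / (tiltedMatrix G q 1).det
      = ((q • (G.laplacian + q • (1 : Matrix V V ℝ))⁻¹).submatrix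
          (Subtype.val : S → V) (Subtype.val : S → V)).det := by
  rw [← det_maskRows_eq_det_submatrix, tiltedMatrix_one]
  set M := G.laplacian + q • (1 : Matrix V V ℝ) with hM
  have hu := (Matrix.isUnit_iff_isUnit_det M).1 (isUnit_laplacian_add G hq)
  rw [div_eq_iff hu.ne_zero, ← Matrix.det_mul]
  congr 1
  have hL : G.laplacian = M - q • 1 := by rw [hM, add_sub_cancel_right]
  have hmul : (q • M⁻¹) * M = q • 1 := by rw [Matrix.smul_mul, Matrix.nonsing_inv_mul _ hu]
  ext i j
  by_cases hi : i ∈ S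
  · have h1 : (maskRows (q • M⁻¹) S * M) i j = ((q • M⁻¹) * M) i j := by
      simp [Matrix.mul_apply, maskRows, hi]
    rw [h1, hmul, tiltedMatrix, Matrix.add_apply, Matrix.diagonal_mul, if_pos hi, zero_mul,
      zero_add]
  · have h1 : (maskRows (q • M⁻¹) S * M) i j = ((1 : Matrix V V ℝ) * M) i j := by
      simp only [Matrix.mul_apply, maskRows, hi, if_false, Matrix.of_apply]
    rw [h1, one_mul, tiltedMatrix, Matrix.add_apply, Matrix.diagonal_mul, if_neg hi, one_mul, hM,
      Matrix.add_apply]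

theorem kernel_posSemidef (G : WeightedGraph V) {q : ℝ} (hq : 0 < q) :
    (q • (G.laplacian + q • (1 : Matrix V V ℝ))⁻¹).PosSemidef :=
  (laplacian_add_posSemidef G hq).inv.smul hq.le

/-- With `M = L + q`, one has `1 - q M⁻¹ = M⁻¹ (L² + q L) M⁻¹`. -/
theorem one_sub_kernel_posSemidef (G : WeightedGraph V) {q : ℝ} (hq : 0 < q) :
    (1 - q • (G.laplacian + q • (1 : Matrix V V ℝ))⁻¹).PosSemidef := by
  set M := G.laplacian + q • (1 : Matrix V V ℝ) with hM
  have hu := (Matrix.isUnit_iff_isUnit_det M).1 (isUnit_laplacian_add G hq)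
  have hL : G.laplacian = M - q • 1 := by rw [hM, add_sub_cancel_right]
  have hH : M⁻¹ᴴ = M⁻¹ := ((laplacian_add_posSemidef G hq).inv).1
  have h1 : (G.laplacianᴴ * G.laplacian + q • G.laplacian).PosSemidef :=
    (Matrix.posSemidef_conjTranspose_mul_self _).add ((laplacian_posSemidef G).smul hq.le)
  have h2 := h1.mul_mul_conjTranspose_same M⁻¹
  rw [hH, (laplacian_isHermitian G).eq] at h2
  have h3 : G.laplacian * G.laplacian + q • G.laplacian = G.laplacian * M := by
    rw [hM, mul_add, Matrix.mul_smul, mul_one]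
  rw [h3, Matrix.mul_assoc, Matrix.mul_assoc, Matrix.mul_nonsing_inv _ hu, mul_one, hL, mul_sub,
    Matrix.nonsing_inv_mul _ hu, Matrix.mul_smul, mul_one] at h2
  exact h2

theorem graphFilter_eq_kernel (G : WeightedGraph V) {q : ℝ} (hq : 0 < q) {U : Matrix V V ℝ}
    {lam : V → ℝ} (h : IsEigendecomposition G.laplacian U lam) :
    graphFilter U lam (fun x => q / (q + x))
      = q • (G.laplacian + q • (1 : Matrix V V ℝ))⁻¹ := by
  obtain ⟨hU, hL⟩ := h
  have h1 : U * Uᵀ = 1 := (Matrix.mem_orthogonalGroup_iff V ℝ).1 hU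
  have h2 : Uᵀ * U = 1 := (Matrix.mem_orthogonalGroup_iff' V ℝ).1 hU
  have hM : G.laplacian + q • (1 : Matrix V V ℝ)
      = U * Matrix.diagonal (fun i => q + lam i) * Uᵀ := by
    have hd : Matrix.diagonal (fun i => q + lam i) = q • (1 : Matrix V V ℝ)
        + Matrix.diagonal lam := by
      rw [← Matrix.diagonal_one, ← Matrix.diagonal_smul, Matrix.diagonal_add]
      simp
    rw [hd, mul_add, add_mul, ← hL, Matrix.mul_smul, mul_one, Matrix.smul_mul, h1, add_comm]
  -- The eigenvalues of the invertible matrix `L + q` are nonzero, so no division by zero occurs.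
  have hlam : ∀ i, q + lam i ≠ 0 := by
    have hu := ((Matrix.isUnit_iff_isUnit_det _).1 (isUnit_laplacian_add G hq)).ne_zero
    rw [hM, Matrix.det_mul, Matrix.det_mul, Matrix.det_diagonal] at hu
    intro i
    exact Finset.prod_ne_zero_iff.1 (right_ne_zero_of_mul (left_ne_zero_of_mul hu)) i
      (Finset.mem_univ i)
  have hinv : (G.laplacian + q • (1 : Matrix V V ℝ))⁻¹
      = U * Matrix.diagonal (fun i => (q + lam i)⁻¹) * Uᵀ := by
    apply Matrix.inv_eq_right_inv
    rw [hM]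
    calc U * Matrix.diagonal (fun i => q + lam i) * Uᵀ
          * (U * Matrix.diagonal (fun i => (q + lam i)⁻¹) * Uᵀ)
        = U * (Matrix.diagonal (fun i => q + lam i) * (Uᵀ * U)
          * Matrix.diagonal (fun i => (q + lam i)⁻¹)) * Uᵀ := by simp only [Matrix.mul_assoc]
      _ = 1 := by
        rw [h2, mul_one, Matrix.diagonal_mul_diagonal]
        simp [hlam, h1]
  rw [hinv, graphFilter, ← Matrix.smul_mul, ← Matrix.mul_smul, ← Matrix.diagonal_smul]
  rfl

end Kernel

/-! ### Wilson's algorithm samples a determinantal point process -/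

theorem mainTheorem3 {V : Type*} [Fintype V] [DecidableEq V] (G : WeightedGraph V)
    {q : ℝ} (hq : 0 < q) (rule : WilsonState V → PMF V) (hrule : IsStartRule rule) :
    ∃ p : PMF (Finset V),
      IsWilsonOutputLaw G hq rule p ∧
      IsUnit (G.laplacian + q • (1 : Matrix V V ℝ)) ∧
      IsDPP p (q • (G.laplacian + q • (1 : Matrix V V ℝ))⁻¹) ∧
      ∀ (U : Matrix V V ℝ) (lam : V → ℝ), IsEigendecomposition G.laplacian U lam →
        IsDPP p (graphFilter U lam (fun x => q / (q + x))) ∧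
        graphFilter U lam (fun x => q / (q + x)) =
          q • (G.laplacian + q • (1 : Matrix V V ℝ))⁻¹ := by
  obtain ⟨p, hp⟩ := exists_isWilsonOutputLaw G hq hrule
  have hdpp : IsDPP p (q • (G.laplacian + q • (1 : Matrix V V ℝ))⁻¹) :=
    ⟨kernel_posSemidef G hq, one_sub_kernel_posSemidef G hq, fun S => by
      rw [hp.toOuterMeasure_subset hrule S, det_tiltedMatrix_div G hq S]⟩
  refine ⟨p, hp, isUnit_laplacian_add G hq, hdpp, fun U lam h => ?_⟩
  rw [graphFilter_eq_kernel G hq h]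
  exact ⟨hdpp, rfl⟩
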